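/- Let $\Delta=\{z\in\mathbb{C} : |z|<1\}$, let $\mathbb{C}_\infty=\mathbb{C}\cup\{\infty\}$, and let $\chi$ be the chordal distance on $\mathbb{C}_\infty$, i.e. $\chi(p,q)$ is the Euclidean distance in $\mathbb{R}^3$ between the points of the sphere $a^2+b^2+(c-\tfrac12)^2=\tfrac14$ that correspond to $p$ and $q$ under stereographic projection from $(0,0,1)$; thus $\chi(z,w)=\frac{|z-w|}{\sqrt{1+|z|^2}\sqrt{1+|w|^2}}$ for $z,w\in\mathbb{C}$. A family $\mathcal{F}$ of meromorphic functions in $\Delta$ (regarded as functions $\Delta\to\mathbb{C}_\infty$ that take the value $\infty$ at their poles) is called normal in $\Delta$ if every sequence in $\mathcal{F}$ has a subsequence $(f_{n_k})$ that converges spherically uniformly on compact subsets of $\Delta$: there is a function $f:\Delta\to\mathbb{C}_\infty$ such that for every compact $K\subseteq\Delta$ and every $\varepsilon>0$ there is $k_0$ with $\chi(f_{n_k}(z),f(z))<\varepsilon$ for all $k>k_0$ and all $z\in K$. Theorem (Montel). Let $\mathcal{F}$ be a family of meromorphic functions in $\Delta$ such that every $f\in\mathcal{F}$ omits the values $0$,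 $1$ and $\infty$ in $\Delta$. Then $\mathcal{F}$ is normal in $\Delta$. -/

import Mathlib

open Filter Topology

noncomputable section

/-- The point of the Riemann sphere
`S = {(a, b, c) ∈ ℝ³ | a² + b² + (c - 1/2)² = 1/4}` that corresponds to a point of the extended
complex plane `ℂ ∪ {∞}` under stereographic projection from the north pole `(0, 0, 1)`. -/
def stereographicPoint : OnePoint ℂ → EuclideanSpace ℝ (Fin 3)
  | none => !₂[0, 0, 1]
  | some z => !₂[z.re / (‖z‖ ^ 2 + 1), z.im / (‖z‖ ^ 2 + 1), ‖z‖ ^ 2 / (‖z‖ ^ 2 + 1)]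

/-- The chordal distance `χ` on the extended complex plane: the Euclidean distance in `ℝ³` between
the corresponding points of the Riemann sphere. -/
def chordalDist (p q : OnePoint ℂ) : ℝ :=
  dist (stereographicPoint p) (stereographicPoint q)

/-- `f` is analytic (and finite) near `z`. -/
def SphereAnalyticAt (f : ℂ → OnePoint ℂ) (z : ℂ) : Prop :=
  ∃ g : ℂ → ℂ, AnalyticAt ℂ g z ∧ ∀ᶠ w in 𝓝 z, f w = (g w : OnePoint ℂ)

/-- `f` has a pole at `z`: it takes the value `∞` there, and on a punctured neighbourhood of `z` it
is finite and given by a function that is meromorphic at `z` of negative order. -/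
def SpherePoleAt (f : ℂ → OnePoint ℂ) (z : ℂ) : Prop :=
  f z = OnePoint.infty ∧
    ∃ g : ℂ → ℂ, MeromorphicAt g z ∧ meromorphicOrderAt g z < 0 ∧
      ∀ᶠ w in 𝓝[≠] z, f w = (g w : OnePoint ℂ)

/-- `f`, as a function with values in the extended complex plane, is meromorphic on `Ω`. Functions
are total; for open `Ω` only the values on `Ω` matter. -/
def IsMeromorphicOn (f : ℂ → OnePoint ℂ) (Ω : Set ℂ) : Prop :=
  ∀ z ∈ Ω, SphereAnalyticAt f z ∨ SpherePoleAt f z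

/-- The sequence `u` converges to `f` spherically uniformly on compact subsets of `Ω`. -/
def SphericallyConvergesOnCompacts (u : ℕ → ℂ → OnePoint ℂ) (f : ℂ → OnePoint ℂ)
    (Ω : Set ℂ) : Prop :=
  ∀ K : Set ℂ, K ⊆ Ω → IsCompact K → ∀ ε : ℝ, 0 < ε →
    ∃ n₀ : ℕ, ∀ n : ℕ, n₀ < n → ∀ z ∈ K, chordalDist (u n z) (f z) < ε

/-- The family `F` is normal in `Ω`: every sequence in `F` has a subsequence that converges
spherically uniformly on compact subsets of `Ω` (the limit may take the value `∞`, even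
identically). -/
def IsNormalFamily (F : Set (ℂ → OnePoint ℂ)) (Ω : Set ℂ) : Prop :=
  ∀ u : ℕ → ℂ → OnePoint ℂ, (∀ n, u n ∈ F) →
    ∃ φ : ℕ → ℕ, StrictMono φ ∧ ∃ f : ℂ → OnePoint ℂ,
      SphericallyConvergesOnCompacts (fun k => u (φ k)) f Ω

/-- `f` omits the value `a` on `Ω`. -/
def OmitsOn (f : ℂ → OnePoint ℂ) (Ω : Set ℂ) (a : OnePoint ℂ) : Prop :=
  ∀ z ∈ Ω, f z ≠ a

end

/-! The family is precompact because omitting 0 and 1 forces local bounds (Schottky). Write `2f - 1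
= cosh H` and `H / (πi) = cosh G`; both lifts exist because `f` omits 0 and 1. Those omissions also
keep `cosh G` off the integers, while every disc of radius 6 contains a point where `cosh` is an
integer. So the image of `G` contains no such disc, and Bloch's theorem bounds `G'`, hence `G`, `H`
and `f`, in terms of `|f 0|`. Arzelà–Ascoli then yields convergent subsequences. When `f 0` is
large, `1/f` is used instead: it omits the same values, and inversion is a chordal isometry. -/

/-! ### Bloch's theorem -/

open Metric Set in
/-- A quantitative open mapping theorem: if `‖f'‖` is at most twice its value at the centre of a
disc, then the image of the disc contains a disc of comparable size. -/
theorem Complex.ball_subset_image_of_norm_deriv_le {f : ℂ → ℂ} {a : ℂ} {t : ℝ} (ht : 0 < t)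
    (hf : DifferentiableOn ℂ f (ball a t)) (h0 : deriv f a ≠ 0)
    (hb : ∀ z ∈ ball a t, ‖deriv f z‖ ≤ 2 * ‖deriv f a‖) :
    ball (f a) (‖deriv f a‖ * t / 24) ⊆ f '' ball a t := by
  set M := ‖deriv f a‖ with hM
  have hM0 : 0 < M := norm_pos_iff.mpr h0
  have hdiff : ∀ z ∈ ball a t, DifferentiableAt ℂ f z := fun z hz =>
    hf.differentiableAt (isOpen_ball.mem_nhds hz)
  -- Schwarz lemma for `f' - f'(a)`, which vanishes at `a` and is at most `3M`.
  have hder : ∀ z ∈ ball a t, ‖deriv f z - deriv f a‖ ≤ 3 * M / t * ‖z - a‖ := by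
    intro z hz
    have := Complex.dist_le_div_mul_dist_of_mapsTo_ball (hf.deriv isOpen_ball) (R₂ := 3 * M)
      (fun w hw => ?_) hz
    · simpa [dist_eq_norm] using this
    · rw [mem_closedBall, dist_eq_norm]
      linarith [norm_sub_le (deriv f w) (deriv f a), hb w hw]
  have hsub : closedBall a (t / 6) ⊆ ball a t := closedBall_subset_ball (by linarith)
  -- On radius `t / 6` the derivative deviates from `f'(a)` by at most `M / 2`, so `f` moves by at
  -- least `M t / 6 - M t / 12`. The open mapping estimate halves this, whence 24.
  have hlow : ∀ z ∈ sphere a (t / 6), M * t / 12 ≤ ‖f z - f a‖ := by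
    intro z hz
    have hza : ‖z - a‖ = t / 6 := by simpa [dist_eq_norm] using hz
    have h1 := (convex_closedBall a (t / 6)).norm_image_sub_le_of_norm_hasDerivWithin_le
      (f := fun w => f w - deriv f a * w) (f' := fun w => deriv f w - deriv f a) (C := M / 2)
      (x := a) (y := z) (fun w hw => ?_) (fun w hw => ?_) (mem_closedBall_self (by positivity))
      (sphere_subset_closedBall hz)
    · have h2 : ‖deriv f a * (z - a)‖ = M * (t / 6) := by rw [norm_mul, hza]
      have h3 : deriv f a * (z - a)
          = (f z - f a) - ((f z - deriv f a * z) - (f a - deriv f a * a)) := by ring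
      have h4 := norm_sub_le (f z - f a) ((f z - deriv f a * z) - (f a - deriv f a * a))
      rw [← h3, h2] at h4
      rw [hza] at h1
      linarith
    · have h5 : HasDerivAt (fun w => f w - deriv f a * w) (deriv f w - deriv f a * 1) w :=
        (hdiff w (hsub hw)).hasDerivAt.sub ((hasDerivAt_id w).const_mul (deriv f a))
      rw [mul_one] at h5
      exact h5.hasDerivWithinAt
    · refine (hder w (hsub hw)).trans ?_
      have : ‖w - a‖ ≤ t / 6 := by simpa [dist_eq_norm] using hw
      calc 3 * M / t * ‖w - a‖ ≤ 3 * M / t * (t / 6) := by gcongr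
        _ = M / 2 := by field_simp; norm_num
  have hfreq : ∃ᶠ z in 𝓝 a, f z ≠ f a :=
    (((hdiff a (mem_ball_self ht)).hasDerivAt.eventually_ne h0).frequently).filter_mono
      nhdsWithin_le_nhds
  have hcl : DiffContOnCl ℂ f (ball a (t / 6)) :=
    (hf.mono (closure_ball_subset_closedBall.trans hsub)).diffContOnCl
  have := hcl.ball_subset_image_closedBall (by positivity) hlow hfreq
  refine (Subset.trans (ball_subset_ball (by linarith)) this).trans (image_mono hsub)

open Metric Set in
/-- **Bloch's theorem**, with an explicit (not optimal) constant. -/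
theorem Complex.exists_ball_subset_image {f : ℂ → ℂ} {c : ℂ} {ρ : ℝ} (hρ : 0 < ρ)
    (hf : DifferentiableOn ℂ f (ball c ρ)) :
    ∃ w, ball w (‖deriv f c‖ * ρ / 96) ⊆ f '' ball c ρ := by
  by_cases hc : deriv f c = 0
  · exact ⟨0, by simp [hc]⟩
  have hsub : closedBall c (ρ / 2) ⊆ ball c ρ := closedBall_subset_ball (by linarith)
  -- Maximising this weight at `a` gives `‖f'‖ ≤ 2 ‖f' a‖` on the disc of radius `t`, half the
  -- distance from `a` to the rim, and `‖f' a‖ t ≥ ‖f' c‖ ρ / 4`; hence 96 = 4 * 24.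
  have hcont : ContinuousOn (fun z => ‖deriv f z‖ * (ρ / 2 - dist z c)) (closedBall c (ρ / 2)) :=
    (((hf.deriv isOpen_ball).continuousOn.mono hsub).norm).mul (by fun_prop)
  obtain ⟨a, ha, hmax⟩ := (isCompact_closedBall c (ρ / 2)).exists_isMaxOn
    ⟨c, mem_closedBall_self (by positivity)⟩ hcont
  have hca := hmax (mem_closedBall_self (by positivity) : c ∈ closedBall c (ρ / 2))
  simp only [mem_ofPred_eq, dist_self, sub_zero] at hca
  have hpos : 0 < ‖deriv f a‖ * (ρ / 2 - dist a c) :=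
    lt_of_lt_of_le (mul_pos (norm_pos_iff.mpr hc) (by positivity)) hca
  have hd : 0 < ρ / 2 - dist a c := by
    by_contra! h
    exact absurd hpos (not_lt.mpr (mul_nonpos_of_nonneg_of_nonpos (norm_nonneg _) h))
  have hda : deriv f a ≠ 0 := by
    rintro h
    simp [h] at hpos
  set t := (ρ / 2 - dist a c) / 2 with ht
  have hball : ball a t ⊆ closedBall c (ρ / 2) := by
    intro z hz
    rw [mem_ball] at hz
    rw [mem_closedBall]
    linarith [dist_triangle z a c]
  refine ⟨f a, ?_⟩
  have key := Complex.ball_subset_image_of_norm_deriv_le (f := f) (a := a) (t := t)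
    (by positivity) (hf.mono (hball.trans hsub)) hda (fun z hz => ?_)
  · refine (ball_subset_ball ?_).trans (key.trans (image_mono (hball.trans hsub)))
    rw [ht]
    linarith
  · have h1 := hmax (hball hz)
    simp only [mem_ofPred_eq] at h1
    have h2 : t ≤ ρ / 2 - dist z c := by
      rw [mem_ball] at hz
      linarith [dist_triangle z a c]
    have h3 : ‖deriv f z‖ * t ≤ ‖deriv f a‖ * (2 * t) := by
      calc ‖deriv f z‖ * t ≤ ‖deriv f z‖ * (ρ / 2 - dist z c) := by gcongr
        _ ≤ _ := h1
        _ = _ := by rw [ht]; ring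
    have ht0 : 0 < t := by positivity
    nlinarith

/-! ### Logarithms, lifts through cosh, and integer values of cosh -/

open Metric Set in
/-- A nonvanishing holomorphic function on a disc has a holomorphic logarithm. -/
theorem Complex.exists_differentiableOn_exp_eq {p : ℂ → ℂ} {c : ℂ} {ρ : ℝ} (hρ : 0 < ρ)
    (hp : DifferentiableOn ℂ p (ball c ρ)) (h0 : ∀ z ∈ ball c ρ, p z ≠ 0) :
    ∃ H : ℂ → ℂ, DifferentiableOn ℂ H (ball c ρ) ∧ (∀ z ∈ ball c ρ, Complex.exp (H z) = p z) ∧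
      H c = Complex.log (p c) := by
  have hc : c ∈ ball c ρ := mem_ball_self hρ
  obtain ⟨H, hHc, hH⟩ := (((hp.deriv isOpen_ball).div hp h0).isExactOn_ball).with_val_at c
    (Complex.log (p c))
  refine ⟨H, fun z hz => (hH z hz).differentiableAt.differentiableWithinAt, fun z hz => ?_, hHc⟩
  have hder : ∀ w ∈ ball c ρ, HasDerivAt (fun w => p w * Complex.exp (-H w)) 0 w := by
    intro w hw
    have h1 := (hp.differentiableAt (isOpen_ball.mem_nhds hw)).hasDerivAt.mul (hH w hw).neg.cexp
    have h2 := h0 w hw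
    refine h1.congr_deriv ?_
    change deriv p w * Complex.exp (-H w) + p w * (Complex.exp (-H w) * -(deriv p w / p w)) = 0
    field_simp
    ring
  have hconst := (convex_ball c ρ).is_const_of_fderivWithin_eq_zero (𝕜 := ℂ)
    (f := fun w => p w * Complex.exp (-H w))
    (fun w hw => (hder w hw).differentiableAt.differentiableWithinAt)
    (fun w hw => by
      rw [fderivWithin_of_isOpen isOpen_ball hw]
      have := (hder w hw).hasFDerivAt.fderiv
      rw [this]; ext; simp) hz hc
  simp only [hHc, Complex.exp_neg, Complex.exp_log (h0 c hc), mul_inv_cancel₀ (h0 c hc)] at hconst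
  have := Complex.exp_ne_zero (H z)
  field_simp at hconst
  exact hconst.symm

open Metric Set in
/-- A holomorphic function on a disc omitting `±1` is `cosh` of a holomorphic function whose value
at the centre is controlled. -/
theorem Complex.exists_differentiableOn_cosh_eq {φ : ℂ → ℂ} {c : ℂ} {ρ : ℝ} (hρ : 0 < ρ)
    (hφ : DifferentiableOn ℂ φ (ball c ρ)) (h1 : ∀ z ∈ ball c ρ, φ z ≠ 1)
    (h2 : ∀ z ∈ ball c ρ, φ z ≠ -1) :
    ∃ H : ℂ → ℂ, DifferentiableOn ℂ H (ball c ρ) ∧ (∀ z ∈ ball c ρ, Complex.cosh (H z) = φ z) ∧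
      ‖H c‖ ≤ Real.log (2 * ‖φ c‖ + 1) + Real.pi := by
  have hc : c ∈ ball c ρ := mem_ball_self hρ
  obtain ⟨L, hL, hexp, -⟩ := Complex.exists_differentiableOn_exp_eq (p := fun z => φ z ^ 2 - 1) hρ
    ((hφ.pow 2).sub_const 1) (fun z hz h => by
      have : (φ z - 1) * (φ z + 1) = 0 := by linear_combination h
      rcases mul_eq_zero.mp this with h | h
      · exact h1 z hz (sub_eq_zero.mp h)
      · exact h2 z hz (eq_neg_of_add_eq_zero_left h))
  -- A square root of `φ² - 1`; as `φ ± k` are reciprocal, a logarithm of `φ + k` inverts `cosh`.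
  set k : ℂ → ℂ := fun z => Complex.exp (L z / 2) with hk
  have hkd : DifferentiableOn ℂ k (ball c ρ) := (hL.div_const 2).cexp
  have hk2 : ∀ z ∈ ball c ρ, k z ^ 2 = φ z ^ 2 - 1 := by
    intro z hz
    rw [← hexp z hz, hk, ← Complex.exp_nat_mul]
    congr 1
    push_cast
    ring
  have hprod : ∀ z ∈ ball c ρ, (φ z + k z) * (φ z - k z) = 1 := fun z hz => by
    linear_combination -hk2 z hz
  obtain ⟨H, hH, hHexp, hHc⟩ := Complex.exists_differentiableOn_exp_eq (p := fun z => φ z + k z) hρ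
    (hφ.add hkd) (fun z hz => left_ne_zero_of_mul_eq_one (hprod z hz))
  refine ⟨H, hH, fun z hz => ?_, ?_⟩
  · rw [Complex.cosh, Complex.exp_neg, hHexp z hz, inv_eq_of_mul_eq_one_right (hprod z hz)]
    ring
  · set B := 2 * ‖φ c‖ + 1 with hB
    have hkc : ‖k c‖ ≤ ‖φ c‖ + 1 := by
      have : ‖k c‖ ^ 2 ≤ ‖φ c‖ ^ 2 + 1 := by
        rw [← norm_pow, hk2 c hc]
        exact (norm_sub_le _ _).trans (by simp)
      nlinarith [norm_nonneg (φ c), norm_nonneg (k c)]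
    have hp : ‖φ c + k c‖ ≤ B := (norm_add_le _ _).trans (by linarith)
    have hm : ‖φ c - k c‖ ≤ B := (norm_sub_le _ _).trans (by linarith)
    have hpm : ‖φ c + k c‖ * ‖φ c - k c‖ = 1 := by rw [← norm_mul, hprod c hc, norm_one]
    have hp0 : 0 < ‖φ c + k c‖ := norm_pos_iff.mpr (left_ne_zero_of_mul_eq_one (hprod c hc))
    have hm0 : 0 < ‖φ c - k c‖ := norm_pos_iff.mpr (right_ne_zero_of_mul_eq_one (hprod c hc))
    rw [hHc]
    refine (Complex.norm_le_abs_re_add_abs_im _).trans (add_le_add ?_ ?_)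
    swap
    · rw [Complex.log_im]
      exact Complex.abs_arg_le_pi _
    rw [Complex.log_re, abs_le]
    -- Since the product is 1, the upper bound on each factor bounds the other from below.
    have hlog : Real.log ‖φ c + k c‖ + Real.log ‖φ c - k c‖ = 0 := by
      rw [← Real.log_mul hp0.ne' hm0.ne', hpm, Real.log_one]
    constructor
    · linarith [Real.log_le_log hm0 hm]
    · exact Real.log_le_log hp0 hp

/-- The points where `cosh` is an integer are relatively dense in the plane. -/
theorem Complex.exists_norm_sub_lt_cosh_eq_intCast (w : ℂ) :
    ∃ g : ℂ, ‖g - w‖ < 6 ∧ ∃ n : ℤ, Complex.cosh g = n := by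
  have real : ∀ t : ℝ, 0 ≤ t → ∃ s : ℝ, |s - t| ≤ 2 ∧ ∃ n : ℤ, Real.cosh s = n := by
    intro t ht
    have h1 : Real.cosh t + 1 ≤ Real.cosh (t + 2) := by
      have h2 : (2 : ℝ) ≤ Real.cosh 2 := by
        rw [Real.cosh_eq]
        have h3 : (3 : ℝ) ≤ Real.exp 2 := by linarith [Real.add_one_le_exp (2 : ℝ)]
        have h4 : Real.exp 2 = Real.exp 1 * Real.exp 1 := by rw [← Real.exp_add]; norm_num
        have h5 : (2 : ℝ) ≤ Real.exp 1 := by linarith [Real.add_one_le_exp (1 : ℝ)]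
        nlinarith [Real.exp_pos (-2)]
      rw [Real.cosh_add]
      have := Real.one_le_cosh t
      have := mul_nonneg (Real.sinh_nonneg_iff.mpr ht)
        (Real.sinh_nonneg_iff.mpr (zero_le_two (α := ℝ)))
      nlinarith
    have hmem : ((⌈Real.cosh t⌉ : ℤ) : ℝ) ∈ Set.Icc (Real.cosh t) (Real.cosh (t + 2)) :=
      ⟨Int.le_ceil _, (Int.ceil_lt_add_one _).le.trans h1⟩
    obtain ⟨s, hs, hsn⟩ := intermediate_value_Icc (by linarith) Real.continuous_cosh.continuousOn
      hmem
    exact ⟨s, abs_le.mpr ⟨by linarith [hs.1], by linarith [hs.2]⟩, _, hsn⟩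
  have real' : ∃ s : ℝ, |s - w.re| ≤ 2 ∧ ∃ n : ℤ, Real.cosh s = n := by
    rcases le_total 0 w.re with h | h
    · exact real _ h
    · obtain ⟨s, hs, n, hn⟩ := real (-w.re) (by linarith)
      refine ⟨-s, ?_, n, by rw [Real.cosh_neg, hn]⟩
      rw [← abs_neg]
      convert hs using 2
      ring
  obtain ⟨s, hs, n, hn⟩ := real'
  -- On the line `Im = mπ`, `cosh` equals `± cosh` of the real part.
  set m : ℤ := round (w.im / Real.pi) with hm
  have him : |m * Real.pi - w.im| ≤ Real.pi / 2 := by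
    have h := abs_sub_round (w.im / Real.pi)
    have hpi := Real.pi_pos
    have : m * Real.pi - w.im = -((w.im / Real.pi - m) * Real.pi) := by field_simp; ring
    rw [this, abs_neg, abs_mul, abs_of_pos hpi]
    nlinarith
  refine ⟨s + (m * Real.pi : ℝ) * Complex.I, ?_, ((-1) ^ m.natAbs) * n, ?_⟩
  · refine (Complex.norm_le_abs_re_add_abs_im _).trans_lt ?_
    have hre : ((s + (m * Real.pi : ℝ) * Complex.I : ℂ) - w).re = s - w.re := by simp
    have him' : ((s + (m * Real.pi : ℝ) * Complex.I : ℂ) - w).im = m * Real.pi - w.im := by simp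
    rw [hre, him']
    linarith [Real.pi_lt_four]
  · rw [Complex.cosh_add, Complex.sinh_mul_I, Complex.cosh_mul_I, ← Complex.ofReal_sin,
      ← Complex.ofReal_cos, Real.sin_int_mul_pi, Real.cos_int_mul_pi, ← Complex.ofReal_cosh, hn]
    rcases Int.even_or_odd m with h | h
    · simp [h.neg_one_zpow, (Int.natAbs_even.mpr h).neg_one_pow]
    · simp [h.neg_one_zpow, (Int.natAbs_odd.mpr h).neg_one_pow]

/-! ### Schottky's theorem -/

open Metric Set in
/-- **Schottky's theorem**: holomorphic functions on the unit disc omitting `0` and `1` and bounded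
at the centre are uniformly bounded on smaller discs. -/
theorem Complex.exists_norm_le_of_omits_zero_one (M : ℝ) {r : ℝ} (hr : r < 1) :
    ∃ B : ℝ, ∀ f : ℂ → ℂ, DifferentiableOn ℂ f (ball 0 1) → (∀ z ∈ ball (0 : ℂ) 1, f z ≠ 0) →
      (∀ z ∈ ball (0 : ℂ) 1, f z ≠ 1) → ‖f 0‖ ≤ M → ∀ z ∈ closedBall (0 : ℂ) r, ‖f z‖ ≤ B := by
  have norm_cosh_le : ∀ w : ℂ, ‖Complex.cosh w‖ ≤ Real.exp ‖w‖ := by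
    intro w
    have h1 := Complex.norm_exp_le_exp_norm w
    have h2 := Complex.norm_exp_le_exp_norm (-w)
    rw [norm_neg] at h2
    rw [Complex.cosh, norm_div, Complex.norm_ofNat]
    linarith [norm_add_le (Complex.exp w) (Complex.exp (-w))]
  -- `A₁` and `A₂` bound the two lifts at 0, and `K` bounds `G` on the smaller disc; 576 = 6 * 96.
  set A₁ := Real.log (2 * (2 * M + 1) + 1) + Real.pi with hA₁
  set A₂ := Real.log (2 * A₁ + 1) + Real.pi with hA₂
  set K := A₂ + 576 / (1 - r) * r with hK
  refine ⟨Real.exp (Real.pi * Real.exp K) + 1, fun f hf hf0 hf1 hfM z hz => ?_⟩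
  have h0 : (0 : ℂ) ∈ ball (0 : ℂ) 1 := mem_ball_self one_pos
  have hsub : closedBall (0 : ℂ) r ⊆ ball 0 1 := closedBall_subset_ball hr
  obtain ⟨H, hH, hHφ, hH0⟩ := Complex.exists_differentiableOn_cosh_eq (φ := fun z => 2 * f z - 1)
    one_pos ((hf.const_mul 2).sub_const 1)
    (fun z hz h => hf1 z hz (by linear_combination h / 2))
    (fun z hz h => hf0 z hz (by linear_combination h / 2))
  have hH0' : ‖H 0‖ ≤ A₁ := by
    refine hH0.trans (add_le_add_left (Real.log_le_log (by positivity) ?_) _)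
    have : ‖2 * f 0 - 1‖ ≤ 2 * M + 1 := (norm_sub_le _ _).trans (by simp; linarith)
    linarith
  -- At `H = nπi` one has `cosh H = ±1`, that is `f = 1` or `f = 0`.
  have hHint : ∀ z ∈ ball (0 : ℂ) 1, ∀ n : ℤ, H z / (Real.pi * Complex.I) ≠ n := by
    intro z hz n hn
    have hpi : (Real.pi : ℂ) * Complex.I ≠ 0 := by simp [Real.pi_ne_zero]
    rw [div_eq_iff hpi] at hn
    have h1 := hHφ z hz
    rw [hn, ← mul_assoc, Complex.cosh_mul_I,
      show (n : ℂ) * Real.pi = ((n * Real.pi : ℝ) : ℂ) by push_cast; rfl,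
      ← Complex.ofReal_cos, Real.cos_int_mul_pi] at h1
    rcases Int.even_or_odd n with h | h
    · rw [h.neg_one_zpow] at h1
      push_cast at h1
      exact hf1 z hz (by linear_combination -h1 / 2)
    · rw [h.neg_one_zpow] at h1
      push_cast at h1
      exact hf0 z hz (by linear_combination -h1 / 2)
  obtain ⟨G, hG, hGφ, hG0⟩ := Complex.exists_differentiableOn_cosh_eq
    (φ := fun z => H z / (Real.pi * Complex.I)) one_pos (hH.div_const _)
    (fun z hz => by simpa using hHint z hz 1) (fun z hz => by simpa using hHint z hz (-1))
  have hG0' : ‖G 0‖ ≤ A₂ := by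
    refine hG0.trans (add_le_add_left (Real.log_le_log (by positivity) ?_) _)
    have : ‖H 0 / (Real.pi * Complex.I)‖ ≤ A₁ := by
      rw [norm_div]
      refine (div_le_self (norm_nonneg _) ?_).trans hH0'
      simp [abs_of_pos Real.pi_pos]
      linarith [Real.pi_gt_three]
    linarith
  have hG' : ∀ w ∈ closedBall (0 : ℂ) r, ‖deriv G w‖ ≤ 576 / (1 - r) := by
    intro w hw
    rw [mem_closedBall, dist_zero_right] at hw
    have hpos : 0 < 1 - r := by linarith
    have hb : ball w (1 - r) ⊆ ball 0 1 := ball_subset_ball' (by simp; linarith)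
    obtain ⟨v, hv⟩ := Complex.exists_ball_subset_image hpos (hG.mono hb)
    by_contra! hlt
    obtain ⟨g, hg, n, hn⟩ := Complex.exists_norm_sub_lt_cosh_eq_intCast v
    rw [div_lt_iff₀ hpos] at hlt
    obtain ⟨x, hx, rfl⟩ := hv (show g ∈ _ by rw [mem_ball, dist_eq_norm]; linarith)
    exact hHint x (hb hx) n (by rw [← hn, hGφ x (hb hx)])
  have hr0 : 0 ≤ r := (norm_nonneg z).trans (by simpa using hz)
  have hGz : ‖G z‖ ≤ K := by
    have h1 := (convex_closedBall (0 : ℂ) r).norm_image_sub_le_of_norm_deriv_le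
      (fun w hw => hG.differentiableAt (isOpen_ball.mem_nhds (hsub hw))) hG'
      (mem_closedBall_self hr0) hz
    have h2 : ‖z - 0‖ ≤ r := by simpa using hz
    have h3 : 576 / (1 - r) * ‖z - 0‖ ≤ 576 / (1 - r) * r := by
      have : 0 < 1 - r := by linarith
      gcongr
    have h4 := norm_add_le (G z - G 0) (G 0)
    rw [sub_add_cancel] at h4
    linarith
  have hHz : ‖H z‖ ≤ Real.pi * Real.exp K := by
    have h1 := (norm_cosh_le (G z)).trans (Real.exp_le_exp.mpr hGz)
    rw [hGφ z (hsub hz), norm_div, div_le_iff₀ (by simp [Real.pi_ne_zero])] at h1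
    simpa [abs_of_pos Real.pi_pos, mul_comm] using h1
  have h1 := (norm_cosh_le (H z)).trans (Real.exp_le_exp.mpr hHz)
  rw [hHφ z (hsub hz)] at h1
  have h2 := norm_add_le (2 * f z - 1) 1
  rw [sub_add_cancel, norm_mul, norm_one, Complex.norm_ofNat] at h2
  linarith [norm_nonneg (f z)]

/-! ### Compactness of locally bounded sequences -/

open Metric Set in
/-- **Montel's theorem** for locally bounded sequences of holomorphic functions. -/
theorem Complex.exists_subseq_tendstoUniformlyOn {U : Set ℂ} (hU : IsOpen U) (u : ℕ → ℂ → ℂ)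
    (hu : ∀ n, DifferentiableOn ℂ (u n) U)
    (hb : ∀ x ∈ U, ∃ B : ℝ, ∀ᶠ z in 𝓝 x, ∀ n, ‖u n z‖ ≤ B) :
    ∃ φ : ℕ → ℕ, StrictMono φ ∧ ∃ f : ℂ → ℂ,
      ∀ K ⊆ U, IsCompact K → TendstoUniformlyOn (fun k => u (φ k)) f atTop K := by
  have hloc : ∀ x : U, ∃ B δ : ℝ, 0 < δ ∧ (∀ n, ‖u n x‖ ≤ B) ∧
      ∀ n, ∀ y ∈ ball (x : ℂ) δ, ‖u n y - u n x‖ ≤ 2 * B / δ * ‖y - x‖ := by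
    intro x
    obtain ⟨B, hB⟩ := hb x x.2
    obtain ⟨δ, hδ, hδ'⟩ := Metric.eventually_nhds_iff_ball.mp (hB.and (hU.mem_nhds x.2))
    have hx : (x : ℂ) ∈ ball (x : ℂ) δ := mem_ball_self hδ
    refine ⟨B, δ, hδ, (hδ' x hx).1, fun n y hy => ?_⟩
    rw [← dist_eq_norm, ← dist_eq_norm]
    refine Complex.dist_le_div_mul_dist_of_mapsTo_ball
      ((hu n).mono fun z hz => (hδ' z hz).2) (fun z hz => ?_) hy
    rw [mem_closedBall, dist_eq_norm]
    linarith [norm_sub_le (u n z) (u n x), (hδ' z hz).1 n, (hδ' x hx).1 n]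
  choose B δ hδ hB hL using hloc
  -- Closed in a product of discs, so compact by Tychonoff; the Lipschitz bounds make it
  -- equicontinuous.
  set T : Set (U → ℂ) := {g | ∀ x, ‖g x‖ ≤ B x ∧
    ∀ y : U, (y : ℂ) ∈ ball (x : ℂ) (δ x) → ‖g y - g x‖ ≤ 2 * B x / δ x * ‖(y : ℂ) - x‖} with hT
  have hTeq : ∀ S : Set (U → ℂ), S ⊆ T → Equicontinuous ((↑) : S → U → ℂ) := by
    intro S hS x
    have hlim : Tendsto (fun y : U => 2 * B x / δ x * ‖(y : ℂ) - x‖) (𝓝 x) (𝓝 0) := by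
      have : Continuous (fun y : U => 2 * B x / δ x * ‖(y : ℂ) - x‖) := by fun_prop
      simpa using this.tendsto x
    refine equicontinuousAt_of_continuity_modulus (x₀ := x) _ hlim _ ?_
    have hnear : ∀ᶠ y : U in 𝓝 x, (y : ℂ) ∈ ball (x : ℂ) (δ x) :=
      continuous_subtype_val.continuousAt (ball_mem_nhds _ (hδ x))
    filter_upwards [hnear] with y hy g
    rw [dist_comm, dist_eq_norm]
    exact ((hS g.2) x).2 y hy
  have hTcompact : IsCompact T := by
    refine (isCompact_univ_pi fun x => isCompact_closedBall (0 : ℂ) (B x)).of_isClosed_subset ?_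
      (fun g hg x _ => by simpa using (hg x).1)
    simp only [hT, ofPred_forall, ofPred_and]
    refine isClosed_iInter fun x => (isClosed_le (by fun_prop) continuous_const).inter ?_
    exact isClosed_iInter fun y => isClosed_iInter fun _ =>
      isClosed_le (by fun_prop) continuous_const
  set S : Set C(U, ℂ) := {g | (g : U → ℂ) ∈ T} with hS
  have himage : ContinuousMap.toFun '' S = T := by
    ext g
    refine ⟨fun ⟨h, hh, he⟩ => he ▸ hh, fun hg => ?_⟩
    exact ⟨⟨g, (hTeq T subset_rfl).continuous ⟨g, hg⟩⟩, hg, rfl⟩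
  have hScompact : IsCompact S := by
    refine ArzelaAscoli.isCompact_of_equicontinuous S (himage ▸ hTcompact) ?_
    exact (hTeq T subset_rfl).comp fun g : S => (⟨g.1, g.2⟩ : T)
  have := hU.locallyCompactSpace
  let v : ℕ → C(U, ℂ) := fun n => ⟨fun x => u n x, (hu n).continuousOn.domRestrict⟩
  obtain ⟨f, -, φ, hφ, hlim⟩ := hScompact.isSeqCompact (x := v)
    (fun n x => ⟨hB x n, fun y hy => hL x n y hy⟩)
  rw [ContinuousMap.tendsto_iff_forall_isCompact_tendstoUniformlyOn] at hlim
  refine ⟨φ, hφ, fun z => by classical exact if h : z ∈ U then f ⟨z, h⟩ else 0, fun K hKU hK => ?_⟩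
  have hK' : IsCompact ((↑) ⁻¹' K : Set U) :=
    Topology.IsInducing.subtypeVal.isCompact_preimage' hK (by simpa using hKU)
  have hunif := hlim _ hK'
  rw [Metric.tendstoUniformlyOn_iff] at hunif ⊢
  intro ε hε
  filter_upwards [hunif ε hε] with n hn z hz
  simp only [hKU hz, dif_pos]
  exact hn ⟨z, hKU hz⟩ hz

/-! ### Chordal metric and reduction to holomorphic functions -/

/-- The chordal distance between finite points. -/
theorem chordalDist_coe_coe (z w : ℂ) : chordalDist (z : OnePoint ℂ) (w : OnePoint ℂ) =
    √(‖z - w‖ ^ 2 / ((‖z‖ ^ 2 + 1) * (‖w‖ ^ 2 + 1))) := by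
  change dist (!₂[z.re / (‖z‖ ^ 2 + 1), z.im / (‖z‖ ^ 2 + 1), ‖z‖ ^ 2 / (‖z‖ ^ 2 + 1)] :
    EuclideanSpace ℝ (Fin 3))
    !₂[w.re / (‖w‖ ^ 2 + 1), w.im / (‖w‖ ^ 2 + 1), ‖w‖ ^ 2 / (‖w‖ ^ 2 + 1)] = _
  rw [EuclideanSpace.dist_eq]
  congr 1
  have hz : (‖z‖ ^ 2 + 1) ≠ 0 := by positivity
  have hw : (‖w‖ ^ 2 + 1) ≠ 0 := by positivity
  simp only [Fin.sum_univ_three, Real.dist_eq, sq_abs]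
  simp only [Complex.sq_norm, Complex.normSq_apply, Complex.sub_re, Complex.sub_im,
    Matrix.cons_val] at hz hw ⊢
  field_simp
  ring

/-- The chordal distance from a finite point to `∞`. -/
theorem chordalDist_coe_infty (z : ℂ) :
    chordalDist (z : OnePoint ℂ) OnePoint.infty = √(1 / (‖z‖ ^ 2 + 1)) := by
  change dist (!₂[z.re / (‖z‖ ^ 2 + 1), z.im / (‖z‖ ^ 2 + 1), ‖z‖ ^ 2 / (‖z‖ ^ 2 + 1)] :
    EuclideanSpace ℝ (Fin 3)) !₂[0, 0, 1] = _
  rw [EuclideanSpace.dist_eq]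
  congr 1
  have hz : (‖z‖ ^ 2 + 1) ≠ 0 := by positivity
  simp only [Fin.sum_univ_three, Real.dist_eq, sq_abs]
  simp only [Complex.sq_norm, Complex.normSq_apply, Matrix.cons_val] at hz ⊢
  field_simp
  ring

/-- On the plane the chordal distance is at most the Euclidean one. -/
theorem chordalDist_coe_coe_le (z w : ℂ) :
    chordalDist (z : OnePoint ℂ) (w : OnePoint ℂ) ≤ ‖z - w‖ := by
  rw [chordalDist_coe_coe]
  refine Real.sqrt_le_iff.mpr ⟨norm_nonneg _, div_le_self (sq_nonneg _) ?_⟩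
  nlinarith [sq_nonneg ‖z‖, sq_nonneg ‖w‖, mul_nonneg (sq_nonneg ‖z‖) (sq_nonneg ‖w‖)]

open Classical in
/-- The inversion `w ↦ 1 / w` as a map from the plane to the extended plane. -/
noncomputable def sphereInv (w : ℂ) : OnePoint ℂ := if w = 0 then OnePoint.infty else (w⁻¹ : ℂ)

/-- Inversion is an isometry for the chordal distance. -/
theorem chordalDist_coe_inv_sphereInv {z : ℂ} (hz : z ≠ 0) (w : ℂ) :
    chordalDist ((z⁻¹ : ℂ) : OnePoint ℂ) (sphereInv w) =
      chordalDist (z : OnePoint ℂ) (w : OnePoint ℂ) := by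
  have hz' := norm_ne_zero_iff.mpr hz
  by_cases hw : w = 0
  · rw [sphereInv, if_pos hw, chordalDist_coe_infty, chordalDist_coe_coe, hw]
    congr 1
    simp only [norm_inv, sub_zero, norm_zero]
    field_simp
    ring
  · have hw' := norm_ne_zero_iff.mpr hw
    rw [sphereInv, if_neg hw, chordalDist_coe_coe, chordalDist_coe_coe]
    congr 1
    rw [inv_sub_inv hz hw, norm_div, norm_mul, norm_sub_rev w z, norm_inv, norm_inv]
    field_simp
    ring

/-- A meromorphic function omitting `∞` is given by a holomorphic function. -/
theorem IsMeromorphicOn.exists_differentiableOn {f : ℂ → OnePoint ℂ} {Ω : Set ℂ}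
    (hf : IsMeromorphicOn f Ω) (hinf : OmitsOn f Ω OnePoint.infty) :
    ∃ g : ℂ → ℂ, DifferentiableOn ℂ g Ω ∧ ∀ z ∈ Ω, f z = (g z : OnePoint ℂ) := by
  let g : ℂ → ℂ := fun z => (f z).elim 0 id
  refine ⟨g, fun z hz => ?_, fun z hz => ?_⟩
  · rcases hf z hz with ⟨h, hh, he⟩ | ⟨h, -⟩
    · have hgh : g =ᶠ[𝓝 z] h := by
        filter_upwards [he] with w hw
        simp [g, hw]
      exact (hgh.differentiableAt_iff.mpr hh.differentiableAt).differentiableWithinAt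
    · exact absurd h (hinf z hz)
  · obtain ⟨w, hw⟩ := OnePoint.ne_infty_iff_exists.mp (hinf z hz)
    simp [g, ← hw]

/-! ### Normality -/

open Metric in
/-- A sequence of holomorphic functions on the unit disc omitting `0` and `1` and bounded at the
centre has a locally uniformly convergent subsequence. -/
theorem Complex.exists_subseq_tendstoUniformlyOn_of_omits_zero_one (u : ℕ → ℂ → ℂ)
    (hu : ∀ n, DifferentiableOn ℂ (u n) (ball 0 1))
    (h0 : ∀ n, ∀ z ∈ ball (0 : ℂ) 1, u n z ≠ 0) (h1 : ∀ n, ∀ z ∈ ball (0 : ℂ) 1, u n z ≠ 1)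
    {M : ℝ} (hM : ∀ n, ‖u n 0‖ ≤ M) :
    ∃ φ : ℕ → ℕ, StrictMono φ ∧ ∃ f : ℂ → ℂ, ∀ K ⊆ ball (0 : ℂ) 1, IsCompact K →
      TendstoUniformlyOn (fun k => u (φ k)) f atTop K := by
  refine Complex.exists_subseq_tendstoUniformlyOn isOpen_ball u hu fun x hx => ?_
  obtain ⟨r, hxr, hr⟩ := exists_between (mem_ball.mp hx)
  obtain ⟨B, hB⟩ := Complex.exists_norm_le_of_omits_zero_one M hr
  refine ⟨B, ?_⟩
  filter_upwards [isOpen_ball.mem_nhds (mem_ball.mpr hxr)] with z hz n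
  exact hB (u n) (hu n) (h0 n) (h1 n) (hM n) z (ball_subset_closedBall hz)

theorem mainTheorem4 (F : Set (ℂ → OnePoint ℂ))
    (hmero : ∀ f ∈ F, IsMeromorphicOn f (Metric.ball (0 : ℂ) 1))
    (hvals : ∀ f ∈ F,
      OmitsOn f (Metric.ball (0 : ℂ) 1) ((0 : ℂ) : OnePoint ℂ) ∧
      OmitsOn f (Metric.ball (0 : ℂ) 1) ((1 : ℂ) : OnePoint ℂ) ∧
      OmitsOn f (Metric.ball (0 : ℂ) 1) OnePoint.infty) :
    IsNormalFamily F (Metric.ball (0 : ℂ) 1) := by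
  intro u hu
  choose g hg hug using fun n =>
    (hmero (u n) (hu n)).exists_differentiableOn (hvals (u n) (hu n)).2.2
  have hg0 : ∀ n, ∀ z ∈ Metric.ball (0 : ℂ) 1, g n z ≠ 0 := fun n z hz h =>
    (hvals (u n) (hu n)).1 z hz (by rw [hug n z hz, h])
  have hg1 : ∀ n, ∀ z ∈ Metric.ball (0 : ℂ) 1, g n z ≠ 1 := fun n z hz h =>
    (hvals (u n) (hu n)).2.1 z hz (by rw [hug n z hz, h])
  by_cases hfreq : ∃ᶠ n in atTop, ‖g n 0‖ ≤ 1
  · obtain ⟨ψ, hψ, hψ'⟩ := extraction_of_frequently_atTop hfreq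
    obtain ⟨φ, hφ, f, hf⟩ := Complex.exists_subseq_tendstoUniformlyOn_of_omits_zero_one
      (fun n => g (ψ n)) (fun n => hg _) (fun n => hg0 _) (fun n => hg1 _) hψ'
    refine ⟨ψ ∘ φ, hψ.comp hφ, fun z => (f z : OnePoint ℂ), fun K hK hKc ε hε => ?_⟩
    obtain ⟨N, hN⟩ := eventually_atTop.mp (Metric.tendstoUniformlyOn_iff.mp (hf K hK hKc) ε hε)
    refine ⟨N, fun n hn z hz => ?_⟩
    have hd := hN n hn.le z hz
    rw [dist_comm, dist_eq_norm] at hd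
    simp only [Function.comp_apply, hug _ z (hK hz)]
    exact (chordalDist_coe_coe_le _ _).trans_lt hd
  · rw [not_frequently] at hfreq
    obtain ⟨ψ, hψ, hψ'⟩ := extraction_of_frequently_atTop hfreq.frequently
    obtain ⟨φ, hφ, f, hf⟩ := Complex.exists_subseq_tendstoUniformlyOn_of_omits_zero_one
      (fun n z => (g (ψ n) z)⁻¹) (fun n => (hg _).inv (hg0 _))
      (fun n z hz => inv_ne_zero (hg0 _ z hz)) (fun n z hz => by simpa using hg1 _ z hz)
      (M := 1) (fun n => by
        rw [norm_inv]
        exact inv_le_one_of_one_le₀ (not_le.mp (hψ' n)).le)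
    -- The limit `f` of the reciprocals may vanish; `sphereInv` sends its zeros to `∞`.
    refine ⟨ψ ∘ φ, hψ.comp hφ, fun z => sphereInv (f z), fun K hK hKc ε hε => ?_⟩
    obtain ⟨N, hN⟩ := eventually_atTop.mp (Metric.tendstoUniformlyOn_iff.mp (hf K hK hKc) ε hε)
    refine ⟨N, fun n hn z hz => ?_⟩
    have hd := hN n hn.le z hz
    rw [dist_comm, dist_eq_norm] at hd
    have hinv := chordalDist_coe_inv_sphereInv (inv_ne_zero (hg0 (ψ (φ n)) z (hK hz))) (f z)
    rw [inv_inv] at hinv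
    simp only [Function.comp_apply, hug _ z (hK hz), hinv]
    exact (chordalDist_coe_coe_le _ _).trans_lt hd
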